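/- Let $n\ge 5$, $k\ge 0$ and $h_1,\dots,h_n\ge 0$ be integers, and let $P_1,\dots,P_n$ and $Q_1,\dots,Q_n$ be two $n$-tuples of linear projections $\mathbb{P}^k\dashrightarrow\mathbb{P}^{h_i}$ over $\mathbb{C}$, given by complex $(h_i+1)\times(k+1)$ matrices $P_i$, $Q_i$ of rank $h_i+1$. Write $X=(x_0,\dots,x_k)^T$ for the vector of homogeneous coordinates on $\mathbb{P}^k$. For integers $0\le\alpha_i\le h_i$ with $\sum_i\alpha_i=k+1$ and complex $(h_i+1)\times(h_i-\alpha_i)$ matrices $S_i'$ of rank $h_i-\alpha_i$, put $S_i=\left(Q_i(X)\mid S_i'\right)$ and consider the square matrix $$T=\begin{pmatrix}P_1&S_1&0&\cdots&0\\P_2&0&S_2&\cdots&0\\\vdots&&&\ddots&\vdots\\P_n&0&0&\cdots&S_n\end{pmatrix},$$ whose determinant is the value of the Grassmann tensor of $P_1,\dots,P_n$ at the subspaces spanned by the columns of the $S_i$. The critical locus $\mathcal{X}\subseteq\mathbb{P}^k$ of the two $n$-tuples is the closed subscheme whose ideal $I(\mathcal{X})\subseteq\mathbb{C}[x_0,\dots,x_k]$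 is generated by all these determinants $\det T$; equivalently, $I(\mathcal{X})$ is generated by the maximal minors (of order $n+k+1$) of the matrix $$M=\begin{pmatrix}P_1&Q_1(X)&0&\cdots&0\\P_2&0&Q_2(X)&\cdots&0\\\vdots&&&\ddots&\vdots\\P_n&0&0&\cdots&Q_n(X)\end{pmatrix}.$$ Assume that $\mathcal{X}$ has the expected dimension $2k-\sum_{i=1}^n h_i$ and that it has codimension $1$, i.e. $\dim\mathcal{X}=k-1\geq 0$. Then either $\mathcal{X}$ is not irreducible (as a topological space), or $\mathcal{X}$ is singular, i.e. at some point of $\mathcal{X}$ the Zariski tangent space of the scheme $\mathcal{X}$ has dimension greater than $\dim\mathcal{X}$. -/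

import Mathlib

noncomputable section

namespace CriticalLocus

/-- The homogeneous coordinate ring `ℂ[x₀, …, x_k]` of `ℙᵏ`. -/
abbrev CoordRing (k : ℕ) : Type := MvPolynomial (Fin (k + 1)) ℂ

/-- The complex projective space `ℙᵏ`. -/
abbrev ProjSpace (k : ℕ) : Type := Projectivization ℂ (Fin (k + 1) → ℂ)

/-! ### Closed subschemes of `ℙᵏ`, given by homogeneous ideals -/

/-- The set of points of `ℙᵏ` at which all elements of `S` vanish. (It is only used for sets of
homogeneous polynomials and for homogeneous ideals, where the choice of homogeneous
coordinates does not matter.) -/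
def zeroLocus {k : ℕ} (S : Set (CoordRing k)) : Set (ProjSpace k) :=
  {x | ∀ f ∈ S, MvPolynomial.eval x.rep f = 0}

/-- Zariski closed subsets of `ℙᵏ`. -/
def IsZariskiClosed {k : ℕ} (Z : Set (ProjSpace k)) : Prop :=
  ∃ S : Set (CoordRing k), (∀ f ∈ S, ∃ m : ℕ, f.IsHomogeneous m) ∧ Z = zeroLocus S

/-- A subset of `ℙᵏ` is irreducible if it is non-empty and is not covered by two Zariski closed
sets unless one of them already contains it. -/
def IsIrreducibleLocus {k : ℕ} (Y : Set (ProjSpace k)) : Prop :=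
  Y.Nonempty ∧ ∀ Z₁ Z₂ : Set (ProjSpace k), IsZariskiClosed Z₁ → IsZariskiClosed Z₂ →
    Y ⊆ Z₁ ∪ Z₂ → Y ⊆ Z₁ ∨ Y ⊆ Z₂

/-- The subscheme of `ℙᵏ` defined by the homogeneous ideal `I` has dimension `d`:
its affine cone, the spectrum of `ℂ[x₀, …, x_k] / I`, has dimension `d + 1`. -/
def HasProjDim {k : ℕ} (I : Ideal (CoordRing k)) (d : ℕ) : Prop :=
  ringKrullDim (CoordRing k ⧸ I) = ((d + 1 : ℕ) : WithBot ℕ∞)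

/-- The Zariski tangent space, at the vector `v`, of the affine cone defined by `I`: the kernel
of the Jacobian matrix at `v` of all the elements of `I`. -/
def coneTangentSpace {k : ℕ} (I : Ideal (CoordRing k)) (v : Fin (k + 1) → ℂ) :
    Submodule ℂ (Fin (k + 1) → ℂ) where
  carrier := {w | ∀ f ∈ I, ∑ j, MvPolynomial.eval v (MvPolynomial.pderiv j f) * w j = 0}
  zero_mem' := by intro f _; simp
  add_mem' := by
    intro a b ha hb f hf
    simp only [Pi.add_apply, mul_add, Finset.sum_add_distrib, ha f hf, hb f hf, add_zero]
  smul_mem' := by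
    intro c a ha f hf
    have h : ∀ j, MvPolynomial.eval v (MvPolynomial.pderiv j f) * (c • a) j
        = c * (MvPolynomial.eval v (MvPolynomial.pderiv j f) * a j) := by
      intro j; simp only [Pi.smul_apply, smul_eq_mul]; ring
    simp only [h, ← Finset.mul_sum, ha f hf, mul_zero]

/-- Jacobian criterion, for the (equidimensional) subscheme of `ℙᵏ` defined by `I`: it is
singular if at some of its points the Zariski tangent space is larger than its dimension.
Both dimensions are those of the affine cone, i.e. one more than the projective ones. -/
def IsSingular {k : ℕ} (I : Ideal (CoordRing k)) : Prop :=
  ∃ x ∈ zeroLocus (I : Set (CoordRing k)),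
    ringKrullDim (CoordRing k ⧸ I) <
      ((Module.finrank ℂ (coneTangentSpace I x.rep) : ℕ) : WithBot ℕ∞)

/-! ### Grassmann tensors and the critical locus -/

section

variable {n k : ℕ} {h : Fin n → ℕ}

/-- The block matrix
`P₁ S₁ 0  … 0`
`P₂ 0  S₂ … 0`
`⋮`
`Pₙ 0  0  … Sₙ`
whose determinant, when it is square, is the Grassmann tensor of `P₁, …, Pₙ` evaluated at the
subspaces spanned by the columns of `S₁, …, Sₙ`. -/
def tensorMatrix {A : Type*} [Zero A] {σ : Fin n → Type*}
    (P : ∀ i, Matrix (Fin (h i + 1)) (Fin (k + 1)) A)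
    (S : ∀ i, Matrix (Fin (h i + 1)) (σ i) A) :
    Matrix (Σ i, Fin (h i + 1)) (Fin (k + 1) ⊕ Σ i, σ i) A :=
  Matrix.fromCols (Matrix.of fun r j => P r.1 r.2 j) (Matrix.blockDiagonal' S)

/-- The constant polynomials of a matrix of complex numbers. -/
def constMatrix {m p : Type*} (A : Matrix m p ℂ) : Matrix m p (CoordRing k) :=
  A.map MvPolynomial.C

/-- The column `Q(X)` of linear forms in the homogeneous coordinates `X = (x₀, …, x_k)`. -/
def imageColumn {m : Type*} (Q : Matrix m (Fin (k + 1)) ℂ) : Matrix m Unit (CoordRing k) :=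
  Matrix.of fun r _ => ∑ j, MvPolynomial.C (Q r j) * MvPolynomial.X j

/-- `f` is, up to sign, the Grassmann tensor of the projections `P₁, …, Pₙ` for some profile
`α₁, …, αₙ`, evaluated at the subspaces `Lᵢ` of codimension `αᵢ` spanned by the image point
`Qᵢ(X)` and `hᵢ - αᵢ` further independent points (the columns of `S' i`). Rows and columns of
the matrix are indexed by different types of the same cardinality; `e` identifies them. -/
def IsCriticalEquation (P Q : ∀ i, Matrix (Fin (h i + 1)) (Fin (k + 1)) ℂ)
    (f : CoordRing k) : Prop :=
  ∃ α : Fin n → ℕ, (∀ i, α i ≤ h i) ∧ ∑ i, α i = k + 1 ∧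
    ∃ S' : ∀ i, Matrix (Fin (h i + 1)) (Fin (h i - α i)) ℂ, (∀ i, (S' i).rank = h i - α i) ∧
    ∃ e : (Σ i, Fin (h i + 1)) ≃ Fin (k + 1) ⊕ Σ i, (Unit ⊕ Fin (h i - α i)),
      f = ((tensorMatrix (fun i => constMatrix (P i))
        (fun i => Matrix.fromCols (imageColumn (Q i)) (constMatrix (S' i)))).submatrix id e).det

/-- The homogeneous ideal of the critical locus of the projections `Q₁, …, Qₙ` with conjugate
projections `P₁, …, Pₙ`. -/
def criticalIdeal (P Q : ∀ i, Matrix (Fin (h i + 1)) (Fin (k + 1)) ℂ) : Ideal (CoordRing k) :=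
  Ideal.span {f | IsCriticalEquation P Q f}

/-- The critical locus, as a set of points of `ℙᵏ`. -/
def criticalLocus (P Q : ∀ i, Matrix (Fin (h i + 1)) (Fin (k + 1)) ℂ) : Set (ProjSpace k) :=
  zeroLocus (criticalIdeal P Q : Set (CoordRing k))

/-- The matrix `M` of constants and linear forms with rows
`(Pᵢ, 0, …, 0, Qᵢ(X), 0, …, 0)`. -/
def criticalMatrix (P Q : ∀ i, Matrix (Fin (h i + 1)) (Fin (k + 1)) ℂ) :
    Matrix (Σ i, Fin (h i + 1)) (Fin (k + 1) ⊕ Σ _ : Fin n, Unit) (CoordRing k) :=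
  tensorMatrix (fun i => constMatrix (P i)) (fun i => imageColumn (Q i))

end

/-! ### The ideal of the critical locus is generated by the maximal minors of `M` -/

theorem det_unit_columns {R ι κ ρ : Type*} [CommRing R] [Fintype ι] [Fintype κ] [Fintype ρ]
    [DecidableEq ι] [DecidableEq κ] [DecidableEq ρ] (A : Matrix ρ ι R) (r : ι → ρ) (s : κ → ρ)
    (hrs : Function.Bijective (Sum.elim r s)) :
    ((Matrix.fromCols A (Matrix.of fun a c => if a = s c then (1 : R) else 0)).submatrix
      (Sum.elim r s) id).det = (A.submatrix r id).det := by
  have hs : Function.Injective s := fun a b hab => by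
    have := @hrs.1 (Sum.inr a) (Sum.inr b) (by simpa using hab)
    simpa using this
  have hd : ∀ a b, r a ≠ s b := fun a b hab => by
    have := @hrs.1 (Sum.inl a) (Sum.inr b) (by simpa using hab)
    simp at this
  have : (Matrix.fromCols A (Matrix.of fun a c => if a = s c then (1 : R) else 0)).submatrix
      (Sum.elim r s) id = Matrix.fromBlocks (A.submatrix r id) 0 (A.submatrix s id) 1 := by
    ext a b
    rcases a with a | a <;> rcases b with b | b <;>
      simp [hd, Matrix.one_apply, hs.eq_iff]
  rw [this, Matrix.det_fromBlocks_zero₁₂]; simp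

theorem det_reindex_mem {R ρ τ τ' : Type*} [CommRing R] [Fintype ρ] [Fintype τ] [Fintype τ']
    [DecidableEq ρ] [DecidableEq τ] [DecidableEq τ'] (T : Matrix ρ τ R) (g : τ' ≃ ρ) (e : ρ ≃ τ)
    (g' : τ' ≃ τ) (J : Ideal R) (hJ : (T.submatrix g g').det ∈ J) : (T.submatrix id e).det ∈ J := by
  have : T.submatrix id e = ((T.submatrix g g').submatrix id (e.trans g'.symm)).submatrix
      g.symm id := by
    ext a b; simp
  have h2 : (T.submatrix id e).det = (((T.submatrix g g').submatrix id (g.trans (e.trans g'.symm)))).det := by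
    rw [← Matrix.det_submatrix_equiv_self g (T.submatrix id e)]
    congr 1
    ext a b; simp
  rw [h2, Matrix.det_permute']
  exact J.mul_mem_left _ hJ

theorem det_fromCols_mem {R ι κ ρ : Type*} [CommRing R] [Fintype ι] [Fintype κ] [Fintype ρ]
    [DecidableEq ι] [DecidableEq κ] [DecidableEq ρ] (A : Matrix ρ ι R) (B : Matrix ρ κ R)
    (e : ρ ≃ ι ⊕ κ) :
    ((Matrix.fromCols A B).submatrix id e).det ∈
      Ideal.span (Set.range fun r : ι → ρ => (A.submatrix r id).det) := by
  classical
  set J := Ideal.span (Set.range fun r : ι → ρ => (A.submatrix r id).det) with hJ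
  have key : ∀ s : κ → ρ, ((Matrix.fromCols A (Matrix.of fun a c => if a = s c then (1 : R)
      else 0)).submatrix e.symm id).det ∈ J := by
    intro s
    by_cases hs : Function.Injective s
    · have hc : Fintype.card ι = Fintype.card ((Set.range s)ᶜ : Set ρ) := by
        rw [Fintype.card_compl_set, Set.card_range_of_injective hs, Fintype.card_congr e]
        simp
      let r : ι → ρ := fun i => (Fintype.equivOfCardEq hc i).1
      have hr : ∀ i, r i ∉ Set.range s := fun i => (Fintype.equivOfCardEq hc i).2
      have hb : Function.Bijective (Sum.elim r s) := by
        rw [Fintype.bijective_iff_injective_and_card]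
        refine ⟨?_, (Fintype.card_congr e).symm⟩
        rintro (a | a) (b | b) hab
        · simpa [r, Subtype.val_inj] using hab
        · exact absurd ⟨b, hab.symm⟩ (hr a)
        · exact absurd ⟨a, hab⟩ (hr b)
        · simpa [hs.eq_iff] using hab
      have h1 := det_unit_columns A r s hb
      have h2 : (((Matrix.fromCols A (Matrix.of fun a c => if a = s c then (1 : R)
          else 0)).submatrix id e).det) ∈ J := by
        apply det_reindex_mem _ (Equiv.ofBijective _ hb) e (Equiv.refl _)
        have h3 : ((Matrix.fromCols A (Matrix.of fun a c => if a = s c then (1 : R)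
          else 0)).submatrix (Equiv.ofBijective _ hb) (Equiv.refl _)).det
            = (A.submatrix r id).det := h1
        rw [h3]
        exact Ideal.subset_span ⟨r, rfl⟩
      rw [← Matrix.det_submatrix_equiv_self e.symm] at h2
      convert h2 using 2
      ext a b; simp
    · rw [Function.Injective] at hs
      push Not at hs
      obtain ⟨c, c', h, hne⟩ := hs
      have : ((Matrix.fromCols A (Matrix.of fun a c => if a = s c then (1 : R)
        else 0)).submatrix e.symm id).det = 0 := by
        apply Matrix.det_zero_of_column_eq (i := Sum.inr c) (j := Sum.inr c') (by simpa using hne)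
        intro k; simp [h]
      rw [this]; exact J.zero_mem
  let D := (Matrix.detRowAlternating (R := R) (n := ι ⊕ κ)).toMultilinearMap
  let u : ι → (ι ⊕ κ → R) := fun i a => A (e.symm a) i
  have hD : ∀ B : Matrix ρ κ R, ((Matrix.fromCols A B).submatrix e.symm id).det
      = D.currySum u (fun c a => B (e.symm a) c) := by
    intro B
    rw [← Matrix.det_transpose, MultilinearMap.currySum_apply]
    change _ = Matrix.det _
    congr 1
    ext a b
    rcases a with a | a <;> rfl
  have h0 : ((Matrix.fromCols A B).submatrix id e).det
      = ((Matrix.fromCols A B).submatrix e.symm id).det := by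
    rw [← Matrix.det_submatrix_equiv_self e.symm]
    congr 1
    ext a b; simp
  rw [h0, hD]
  have hB : (fun (c : κ) (a : ι ⊕ κ) => B (e.symm a) c)
      = fun c => ∑ t : ρ, B t c • (fun a : ι ⊕ κ => if e.symm a = t then (1 : R) else 0) := by
    funext c a
    simp [Finset.sum_apply]
  rw [hB, MultilinearMap.map_sum]
  refine J.sum_mem fun s _ => ?_
  rw [MultilinearMap.map_smul_univ, smul_eq_mul]
  refine J.mul_mem_left _ ?_
  have := key s
  rw [hD] at this
  exact this

/-- The ideal of the critical locus is generated by the maximal minors of the matrix `M`. (The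
selections `r` of rows with repetitions only contribute zeros.) -/
theorem criticalIdeal_eq_span_minors {n k : ℕ} {h : Fin n → ℕ}
    (P Q : ∀ i, Matrix (Fin (h i + 1)) (Fin (k + 1)) ℂ) :
    criticalIdeal P Q = Ideal.span (Set.range
      fun r : (Fin (k + 1) ⊕ Σ _ : Fin n, Unit) → Σ i, Fin (h i + 1) =>
        ((criticalMatrix P Q).submatrix r id).det) := by
  classical
  -- the columns of a Grassmann tensor matrix, regrouped
  have regroup : ∀ (α : Fin n → ℕ) (S' : ∀ i, Matrix (Fin (h i + 1)) (Fin (h i - α i)) ℂ),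
      (tensorMatrix (fun i => constMatrix (P i))
        (fun i => Matrix.fromCols (imageColumn (Q i)) (constMatrix (S' i)))) =
      (Matrix.fromCols (criticalMatrix P Q)
        (Matrix.blockDiagonal' fun i => constMatrix (k := k) (S' i))).submatrix id
        (((Equiv.refl _).sumCongr (Equiv.sigmaSumDistrib _ _)).trans
          (Equiv.sumAssoc _ _ _).symm) := by
    intro α S'
    ext ⟨i, a⟩ c
    rcases c with c | ⟨j, c | c⟩
    · simp [tensorMatrix, criticalMatrix]
    · by_cases hij : i = j
      · subst hij; simp [tensorMatrix, criticalMatrix, Matrix.blockDiagonal'_apply]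
      · simp [tensorMatrix, criticalMatrix, Matrix.blockDiagonal'_apply, hij]
    · by_cases hij : i = j
      · subst hij; simp [tensorMatrix, criticalMatrix, Matrix.blockDiagonal'_apply]
      · simp [tensorMatrix, criticalMatrix, Matrix.blockDiagonal'_apply, hij]
  apply le_antisymm
  · refine Ideal.span_le.2 ?_
    rintro f ⟨α, -, -, S', -, e, rfl⟩
    rw [regroup α S', Matrix.submatrix_submatrix]
    exact det_fromCols_mem _ _ (e.trans (((Equiv.refl _).sumCongr
      (Equiv.sigmaSumDistrib _ _)).trans (Equiv.sumAssoc _ _ _).symm))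
  · refine Ideal.span_le.2 ?_
    rintro _ ⟨r, rfl⟩
    by_cases hr : Function.Injective r
    swap
    · rw [Function.Injective] at hr
      push Not at hr
      obtain ⟨c, c', hcc, hne⟩ := hr
      have : ((criticalMatrix P Q).submatrix r id).det = 0 :=
        Matrix.det_zero_of_row_eq hne (by funext x; simp [hcc])
      simp [this]
    let miss : ∀ i, Finset (Fin (h i + 1)) := fun i => Finset.univ.filter fun a =>
      (⟨i, a⟩ : Σ i, Fin (h i + 1)) ∉ Set.range r
    by_cases hm : ∃ i, miss i = Finset.univ
    · obtain ⟨i, hi⟩ := hm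
      have : ((criticalMatrix P Q).submatrix r id).det = 0 := by
        apply Matrix.det_eq_zero_of_column_eq_zero (Sum.inr ⟨i, ()⟩)
        intro c
        have hne : (r c).1 ≠ i := by
          intro hc
          rcases hrc : r c with ⟨j, a⟩
          rw [hrc] at hc
          subst hc
          have : a ∈ miss j := by rw [hi]; simp
          simp only [miss, Finset.mem_filter] at this
          exact this.2 ⟨c, hrc⟩
        rcases hrc : r c with ⟨j, a⟩
        rw [hrc] at hne
        simp [hrc, criticalMatrix, tensorMatrix, Matrix.blockDiagonal'_apply, hne]
      simp [this]
    push Not at hm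
    have hlt : ∀ i, (miss i).card ≤ h i := by
      intro i
      have := Finset.card_lt_univ_of_notMem
        (Classical.choose_spec (not_forall.1 (mt Finset.eq_univ_iff_forall.2 (hm i))))
      simp only [Fintype.card_fin] at this
      omega
    let α : Fin n → ℕ := fun i => h i - (miss i).card
    have hα : ∀ i, h i - α i = (miss i).card := fun i => by
      have := hlt i; simp only [α]; omega
    let s : ∀ i, Fin (h i - α i) ↪o Fin (h i + 1) := fun i => (miss i).orderEmbOfFin (hα i).symm
    have hs : ∀ i c, s i c ∈ miss i := fun i c => Finset.orderEmbOfFin_mem _ _ _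
    let s' : (Σ i, Fin (h i - α i)) → Σ i, Fin (h i + 1) := fun c => ⟨c.1, s c.1 c.2⟩
    have hb : Function.Bijective (Sum.elim r s') := by
      constructor
      · rintro (a | a) (b | b) hab
        · simpa [hr.eq_iff] using hab
        · have := hs b.1 b.2
          simp only [miss, Finset.mem_filter] at this
          exact absurd ⟨a, hab⟩ this.2
        · have := hs a.1 a.2
          simp only [miss, Finset.mem_filter] at this
          exact absurd ⟨b, hab.symm⟩ this.2
        · rcases a with ⟨i, a⟩
          rcases b with ⟨j, b⟩
          simp only [s', Sum.elim_inr, Sigma.mk.injEq] at hab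
          obtain ⟨rfl, hab⟩ := hab
          have := (s i).injective (eq_of_heq hab)
          rw [this]
      · rintro ⟨i, a⟩
        by_cases ha : (⟨i, a⟩ : Σ i, Fin (h i + 1)) ∈ Set.range r
        · obtain ⟨c, hc⟩ := ha
          exact ⟨Sum.inl c, hc⟩
        · have : a ∈ Set.range (s i) := by
            simp only [s, Finset.range_orderEmbOfFin]
            simpa [miss] using ha
          obtain ⟨c, hc⟩ := this
          exact ⟨Sum.inr ⟨i, c⟩, by simp [s', hc]⟩
    let S' : ∀ i, Matrix (Fin (h i + 1)) (Fin (h i - α i)) ℂ := fun i =>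
      Matrix.of fun a c => if a = s i c then 1 else 0
    let g := Equiv.ofBijective _ hb
    let e₀ : (Fin (k + 1) ⊕ Σ i : Fin n, (Unit ⊕ Fin (h i - α i))) ≃
        (Fin (k + 1) ⊕ Σ _ : Fin n, Unit) ⊕ Σ i, Fin (h i - α i) :=
      ((Equiv.refl _).sumCongr (Equiv.sigmaSumDistrib _ _)).trans
          (Equiv.sumAssoc _ _ _).symm
    refine Ideal.subset_span ⟨α, fun i => Nat.sub_le _ _, ?_, S', ?_, g.symm.trans e₀.symm, ?_⟩
    · have hc := Fintype.card_congr g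
      simp only [Fintype.card_sum, Fintype.card_sigma, Fintype.card_fin, Fintype.card_unit,
        Finset.sum_const, Finset.card_univ, smul_eq_mul, mul_one, Finset.sum_add_distrib] at hc
      have h2 : ∑ i, h i = ∑ i, α i + ∑ i, (h i - α i) := by
        rw [← Finset.sum_add_distrib]
        exact Finset.sum_congr rfl fun i _ => by simp only [α]; omega
      omega
    · intro i
      rw [← Matrix.rank_transpose]
      have hl : LinearIndependent ℂ (S' i).transpose.row := by
        have := (Pi.basisFun ℂ (Fin (h i + 1))).linearIndependent.comp _ (s i).injective
        convert this using 1
        ext c a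
        simp [S', Pi.single_apply, Matrix.row]
      rw [hl.rank_matrix, Fintype.card_fin]
    · rw [regroup α S', Matrix.submatrix_submatrix]
      have hS : (Matrix.blockDiagonal' fun i => constMatrix (k := k) (S' i)) =
          Matrix.of fun a c => if a = s' c then (1 : CoordRing k) else 0 := by
        ext ⟨i, a⟩ ⟨j, c⟩
        by_cases hij : i = j
        · subst hij
          by_cases hac : a = s i c <;>
            simp [Matrix.blockDiagonal'_apply, constMatrix, S', s', hac]
        · simp [Matrix.blockDiagonal'_apply, hij, s']
      beta_reduce
      rw [hS, ← det_unit_columns (criticalMatrix P Q) r s' hb]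
      conv_rhs => rw [← Matrix.det_submatrix_equiv_self g]
      rw [Matrix.submatrix_submatrix]
      congr 1
      funext a b
      have hbb : e₀ (e₀.symm (g.symm (g b))) = b := by simp
      change Matrix.fromCols _ _ (g a) b = Matrix.fromCols _ _ (g a)
        (e₀ (e₀.symm (g.symm (g b))))
      rw [hbb]

end CriticalLocus

end

namespace CriticalLocus

open MvPolynomial

/-! Codimension one together with the expected dimension forces `∑ hᵢ = k + 1`. The scheme is
therefore singular as soon as all maximal minors of `M` vanish to second order at one vector `v ≠
0`: every derivative is then zero at `v`, and the tangent space of the cone is all of `ℂ^(k+1)`,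
while the cone has dimension `k`.

The column of `Qᵢ(X)` vanishes on the centre of `Qᵢ`, so where the centres of `Qᵢ` and `Qⱼ` meet
each term of a minor has two vanishing factors (`criticalIdeal_le_sq`). The centres meet whenever
`hᵢ + hⱼ + 2 ≤ k`. With at least five indices, the two smallest `hᵢ` satisfy this
(`exists_ne_add_le`), except when `k = 1`, where both are `0`.

In that exceptional case `Qᵢ(X)` is a single linear form dividing every minor. If the centres of
`Qᵢ` and `Qⱼ` are distinct points of `ℙ¹`, both lie on the locus. Irreducibility then makes the
cofactors vanish on the whole locus, in particular at the centre of `Qᵢ`, where the minors have a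
double zero (`criticalIdeal_le_sq_of_irreducible`). -/

/-! ### Second-order vanishing and the tangent space -/

/-- The ideal of the polynomials that vanish at the vector `v`. -/
noncomputable def vanishingIdealAt {k : ℕ} (v : Fin (k + 1) → ℂ) : Ideal (CoordRing k) :=
  RingHom.ker (eval v)

theorem mem_vanishingIdealAt {k : ℕ} {v : Fin (k + 1) → ℂ} {f : CoordRing k} :
    f ∈ vanishingIdealAt v ↔ eval v f = 0 := Iff.rfl

/-- By the Leibniz rule, each term of the derivative of a product `a * b` keeps one undifferentiated
factor, which vanishes at `v`. -/
theorem eval_pderiv_eq_zero_of_mem_sq {k : ℕ} {v : Fin (k + 1) → ℂ} {f : CoordRing k}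
    (hf : f ∈ vanishingIdealAt v * vanishingIdealAt v) (j : Fin (k + 1)) :
    eval v (pderiv j f) = 0 := by
  induction hf using Submodule.mul_induction_on' with
  | mem_mul_mem a ha b hb =>
    rw [mem_vanishingIdealAt] at ha hb
    simp [Derivation.leibniz, ha, hb]
  | add a _ b _ ha hb => simp [ha, hb]

/-- A subscheme whose equations vanish to second order at a point is singular there, unless it
fills the whole space. -/
theorem isSingular_of_le_sq {k : ℕ} {I : Ideal (CoordRing k)} (x : ProjSpace k)
    (hI : I ≤ vanishingIdealAt x.rep * vanishingIdealAt x.rep)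
    (hdim : ringKrullDim (CoordRing k ⧸ I) < ((k + 1 : ℕ) : WithBot ℕ∞)) : IsSingular I := by
  refine ⟨x, fun f hf => Ideal.mul_le_left (hI hf), ?_⟩
  have htop : coneTangentSpace I x.rep = ⊤ := by
    refine eq_top_iff.2 fun w _ f hf => Finset.sum_eq_zero fun j _ => ?_
    rw [eval_pderiv_eq_zero_of_mem_sq (hI hf), zero_mul]
  rw [htop, finrank_top, Module.finrank_fin_fun]
  exact hdim

/-! ### Determinants: ideal membership and degree -/

theorem det_mem_of_column_mem {R m : Type*} [CommRing R] [Fintype m] [DecidableEq m]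
    {J : Ideal R} {A : Matrix m m R} (c : m) (hc : ∀ a, A a c ∈ J) : A.det ∈ J := by
  rw [Matrix.det_apply]
  refine J.sum_mem fun σ _ => Submodule.smul_of_tower_mem J _ ?_
  exact J.prod_mem (Finset.mem_univ c) (hc _)

/-- Every term of the Leibniz expansion contains one entry from each of the two distinct columns. -/
theorem det_mem_mul_of_columns_mem {R m : Type*} [CommRing R] [Fintype m] [DecidableEq m]
    {J K : Ideal R} {A : Matrix m m R} {c c' : m} (hne : c ≠ c') (hc : ∀ a, A a c ∈ J)
    (hc' : ∀ a, A a c' ∈ K) : A.det ∈ J * K := by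
  rw [Matrix.det_apply]
  refine (J * K).sum_mem fun σ _ => Submodule.smul_of_tower_mem (J * K) _ ?_
  rw [← Finset.mul_prod_erase _ _ (Finset.mem_univ c)]
  exact Ideal.mul_mem_mul (hc _)
    (K.prod_mem (Finset.mem_erase.2 ⟨hne.symm, Finset.mem_univ c'⟩) (hc' _))

theorem isHomogeneous_det {σ R m : Type*} [CommRing R] [Fintype m] [DecidableEq m]
    {A : Matrix m m (MvPolynomial σ R)} {e : m → ℕ} (hA : ∀ a c, (A a c).IsHomogeneous (e c)) :
    A.det.IsHomogeneous (∑ c, e c) := by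
  rw [Matrix.det_apply]
  refine IsHomogeneous.sum _ _ _ fun τ _ => ?_
  exact Submodule.smul_of_tower_mem (homogeneousSubmodule σ R _) _
    (IsHomogeneous.prod _ _ _ fun c _ => hA _ _)

/-! ### Minors of `M` at the centres of the `Qᵢ` -/

section

variable {n k : ℕ} {h : Fin n → ℕ}

theorem eval_imageColumn {m : Type*} (Q : Matrix m (Fin (k + 1)) ℂ) (v : Fin (k + 1) → ℂ)
    (a : m) (u : Unit) : eval v (imageColumn Q a u) = Q.mulVec v a := by
  simp [imageColumn, Matrix.mulVec, dotProduct]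

theorem isHomogeneous_imageColumn {m : Type*} (Q : Matrix m (Fin (k + 1)) ℂ) (a : m) (u : Unit) :
    (imageColumn Q a u).IsHomogeneous 1 := by
  rw [imageColumn, Matrix.of_apply]
  exact IsHomogeneous.sum _ _ _ fun j _ => by
    simpa using (isHomogeneous_C _ (Q a j)).mul (isHomogeneous_X ℂ j)

theorem criticalMatrix_inr_mem (P Q : ∀ i, Matrix (Fin (h i + 1)) (Fin (k + 1)) ℂ) {i : Fin n}
    {v : Fin (k + 1) → ℂ} (hv : (Q i).mulVec v = 0) (a : Σ i, Fin (h i + 1)) :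
    criticalMatrix P Q a (Sum.inr ⟨i, ()⟩) ∈ vanishingIdealAt v := by
  obtain ⟨j, a⟩ := a
  rw [mem_vanishingIdealAt]
  by_cases hij : j = i
  · subst hij
    simp [criticalMatrix, tensorMatrix, Matrix.blockDiagonal'_apply, eval_imageColumn, hv]
  · simp [criticalMatrix, tensorMatrix, Matrix.blockDiagonal'_apply, hij]

/-- The critical locus contains the centres of the projections `Qᵢ`. -/
theorem mem_criticalLocus (P Q : ∀ i, Matrix (Fin (h i + 1)) (Fin (k + 1)) ℂ) {i : Fin n}
    {x : ProjSpace k} (hx : (Q i).mulVec x.rep = 0) : x ∈ criticalLocus P Q := by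
  have : criticalIdeal P Q ≤ vanishingIdealAt x.rep := by
    rw [criticalIdeal_eq_span_minors, Ideal.span_le]
    rintro _ ⟨r, rfl⟩
    exact det_mem_of_column_mem (Sum.inr ⟨i, ()⟩) fun a => criticalMatrix_inr_mem P Q hx _
  exact fun f hf => this hf

/-- The equations of the critical locus vanish to second order where the centres of two of the
projections `Qᵢ` meet. -/
theorem criticalIdeal_le_sq (P Q : ∀ i, Matrix (Fin (h i + 1)) (Fin (k + 1)) ℂ) {i j : Fin n}
    (hij : i ≠ j) {v : Fin (k + 1) → ℂ} (hi : (Q i).mulVec v = 0) (hj : (Q j).mulVec v = 0) :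
    criticalIdeal P Q ≤ vanishingIdealAt v * vanishingIdealAt v := by
  rw [criticalIdeal_eq_span_minors, Ideal.span_le]
  rintro _ ⟨r, rfl⟩
  refine det_mem_mul_of_columns_mem (c := Sum.inr ⟨i, ()⟩) (c' := Sum.inr ⟨j, ()⟩) ?_
    (fun a => criticalMatrix_inr_mem P Q hi _) (fun a => criticalMatrix_inr_mem P Q hj _)
  simpa using hij

/-- The matrix `M` with the column of `Qᵢ(X)` replaced by the indicator of the `i`-th block of
rows. -/
noncomputable def reducedMatrix (P Q : ∀ i, Matrix (Fin (h i + 1)) (Fin (k + 1)) ℂ) (i : Fin n) :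
    Matrix (Σ i, Fin (h i + 1)) (Fin (k + 1) ⊕ Σ _ : Fin n, Unit) (CoordRing k) :=
  (criticalMatrix P Q).updateCol (Sum.inr ⟨i, ()⟩) fun a => if a.1 = i then 1 else 0

/-- If `hᵢ = 0`, the linear form `Qᵢ(X)` divides the maximal minors of `M`. -/
theorem minor_eq_mul (P Q : ∀ i, Matrix (Fin (h i + 1)) (Fin (k + 1)) ℂ) {i : Fin n}
    (hi : h i = 0) (r : (Fin (k + 1) ⊕ Σ _ : Fin n, Unit) → Σ i, Fin (h i + 1)) :
    ((criticalMatrix P Q).submatrix r id).det =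
      -- Since `hᵢ = 0`, block `i` is a single row, so the column of `Qᵢ(X)` is that linear form
      -- times the indicator of the block.
      imageColumn (Q i) 0 () * ((reducedMatrix P Q i).submatrix r id).det := by
  have hM : (criticalMatrix P Q).submatrix r id =
      ((criticalMatrix P Q).submatrix r id).updateCol (Sum.inr ⟨i, ()⟩)
        (imageColumn (Q i) 0 () • fun c => if (r c).1 = i then 1 else 0) := by
    ext c b
    by_cases hb : b = Sum.inr ⟨i, ()⟩
    swap
    · rw [Matrix.updateCol_ne hb]
    subst hb
    rw [Matrix.updateCol_self]
    rcases hrc : r c with ⟨j, a⟩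
    by_cases hij : j = i
    · subst hij
      have ha : a = 0 := by ext; have := a.2; simp; omega
      simp [hrc, ha, criticalMatrix, tensorMatrix, Matrix.blockDiagonal'_apply]
    · simp [hrc, hij, criticalMatrix, tensorMatrix, Matrix.blockDiagonal'_apply]
  rw [hM, Matrix.det_updateCol_smul]
  congr 2

/-- Homogeneity is what lets the common zeros of these minors count as a Zariski closed set in the
definition of irreducibility. -/
theorem isHomogeneous_reducedMatrix_minor (P Q : ∀ i, Matrix (Fin (h i + 1)) (Fin (k + 1)) ℂ)
    (i : Fin n) (r : (Fin (k + 1) ⊕ Σ _ : Fin n, Unit) → Σ i, Fin (h i + 1)) :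
    ∃ m : ℕ, ((reducedMatrix P Q i).submatrix r id).det.IsHomogeneous m := by
  refine ⟨_, isHomogeneous_det
    -- Column degrees: the `P`-columns and the indicator column are constant, the other `Qⱼ(X)` are
    -- linear.
    (e := Sum.elim (fun _ => 0) fun j => if j.1 = i then 0 else 1) fun c b => ?_⟩
  rcases hrc : r c with ⟨l, a⟩
  rcases b with b | ⟨j, _⟩
  · simpa [hrc, reducedMatrix, criticalMatrix, tensorMatrix, constMatrix] using
      isHomogeneous_C _ _
  · by_cases hj : j = i
    · subst hj
      by_cases hl : l = j
      · simpa [hrc, reducedMatrix, hl] using isHomogeneous_one _ _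
      · simpa [hrc, reducedMatrix, hl] using isHomogeneous_zero _ _ _
    · by_cases hl : l = j
      · subst hl
        simpa [hrc, reducedMatrix, hj, criticalMatrix, tensorMatrix,
          Matrix.blockDiagonal'_apply] using isHomogeneous_imageColumn (Q l) a ()
      · simpa [hrc, reducedMatrix, hj, hl, criticalMatrix, tensorMatrix,
          Matrix.blockDiagonal'_apply] using isHomogeneous_zero _ _ _

/-- If `hᵢ = 0` and the critical locus is irreducible but not contained in the hyperplane
`Qᵢ(X) = 0`, its equations vanish to second order on that hyperplane. -/
theorem criticalIdeal_le_sq_of_irreducible (P Q : ∀ i, Matrix (Fin (h i + 1)) (Fin (k + 1)) ℂ)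
    (hirr : IsIrreducibleLocus (criticalLocus P Q)) {i : Fin n} (hi : h i = 0)
    {x y : ProjSpace k} (hx : (Q i).mulVec x.rep = 0) (hy : (Q i).mulVec y.rep ≠ 0)
    (hyc : y ∈ criticalLocus P Q) :
    criticalIdeal P Q ≤ vanishingIdealAt x.rep * vanishingIdealAt x.rep := by
  have hcover : criticalLocus P Q ⊆ zeroLocus {imageColumn (Q i) 0 ()} ∪ zeroLocus (Set.range
      fun r : (Fin (k + 1) ⊕ Σ _ : Fin n, Unit) → Σ i, Fin (h i + 1) =>
        ((reducedMatrix P Q i).submatrix r id).det) := by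
    intro z hz
    refine or_iff_not_imp_left.2 fun hzq => ?_
    rintro _ ⟨r, rfl⟩
    have h0 : eval z.rep ((criticalMatrix P Q).submatrix r id).det = 0 := by
      refine hz _ ?_
      rw [criticalIdeal_eq_span_minors]
      exact Ideal.subset_span ⟨r, rfl⟩
    rw [minor_eq_mul P Q hi, map_mul, mul_eq_zero] at h0
    exact h0.resolve_left fun hq => hzq fun f hf => by rw [Set.mem_singleton_iff.1 hf, hq]
  -- The point `y` excludes the hyperplane, so the whole locus lies in the zeros of the cofactors.
  have hsub := (hirr.2 _ _ ⟨_, by rintro _ rfl; exact ⟨1, isHomogeneous_imageColumn _ _ _⟩, rfl⟩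
    ⟨_, by rintro _ ⟨r, rfl⟩; exact isHomogeneous_reducedMatrix_minor P Q i r, rfl⟩
    hcover).resolve_left fun hs => by
      refine hy (funext fun a => ?_)
      have ha : a = 0 := by ext; have := a.2; simp; omega
      rw [ha, ← eval_imageColumn _ _ _ ()]
      exact hs hyc _ rfl
  rw [criticalIdeal_eq_span_minors, Ideal.span_le]
  rintro _ ⟨r, rfl⟩
  simp only [minor_eq_mul P Q hi]
  -- At `x` both factors vanish: the cofactor because `x` is itself on the locus, the linear form
  -- because `x` is in the centre.
  refine Ideal.mul_mem_mul ?_ (hsub (mem_criticalLocus P Q hx) _ ⟨r, rfl⟩)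
  rw [mem_vanishingIdealAt, eval_imageColumn, hx]
  rfl

end

/-! ### Existence of points on the centres -/

theorem exists_point_of_finrank_lt {k : ℕ} {W : Type*} [AddCommGroup W] [Module ℂ W]
    [FiniteDimensional ℂ W] (φ : (Fin (k + 1) → ℂ) →ₗ[ℂ] W) (hW : Module.finrank ℂ W < k + 1) :
    ∃ x : ProjSpace k, φ x.rep = 0 := by
  have hker := LinearMap.ker_ne_bot_of_finrank_lt (f := φ)
    (by rwa [Module.finrank_fin_fun])
  obtain ⟨v, hv, hv0⟩ := (Submodule.ne_bot_iff _).1 hker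
  refine ⟨Projectivization.mk ℂ v hv0, ?_⟩
  -- The chosen representative is only a scalar multiple of `v`, which linearity of `φ` absorbs.
  obtain ⟨a, ha⟩ := Projectivization.exists_smul_eq_mk_rep ℂ v hv0
  rw [← ha, Units.smul_def, map_smul, LinearMap.mem_ker.1 hv, smul_zero]

/-- Among five of the `hᵢ`, the two smallest add up to at most `2(k + 1)/5`, which is at most `k -
2` once `k ≥ 4`. For `k = 2` two of the five are `0`, and for `k = 3` the two smallest add up to at
most `1`. For `k = 1` the bound is out of reach, but two of the five are `0`. Four indices would not
suffice: `k = 3` with all `hᵢ = 1` fails. -/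
theorem exists_ne_add_le {n k : ℕ} (hn : 5 ≤ n) (hk : 1 ≤ k) (h : Fin n → ℕ)
    (hsum : ∑ i, h i = k + 1) :
    ∃ i j, i ≠ j ∧ (h i + h j + 2 ≤ k ∨ (k = 1 ∧ h i = 0 ∧ h j = 0)) := by
  by_contra! hcon
  have hle : ∑ i : Fin 5, h (Fin.castLE hn i) ≤ k + 1 := by
    rw [← hsum]
    exact (Finset.sum_map Finset.univ (Fin.castLEEmb hn) h).symm.trans_le
      (Finset.sum_le_sum_of_subset (Finset.subset_univ _))
  rw [Fin.sum_univ_five] at hle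
  have key : ∀ i j : Fin 5, i ≠ j → k < h (Fin.castLE hn i) + h (Fin.castLE hn j) + 2 ∧
      (k = 1 → h (Fin.castLE hn i) = 0 → h (Fin.castLE hn j) ≠ 0) := fun i j hij =>
    hcon _ _ fun he => hij (Fin.castLE_injective hn he)
  have h01 := key 0 1 (by decide)
  have h02 := key 0 2 (by decide)
  have h03 := key 0 3 (by decide)
  have h04 := key 0 4 (by decide)
  have h12 := key 1 2 (by decide)
  have h13 := key 1 3 (by decide)
  have h14 := key 1 4 (by decide)
  have h23 := key 2 3 (by decide)
  have h24 := key 2 4 (by decide)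
  have h34 := key 3 4 (by decide)
  omega

end CriticalLocus

open CriticalLocus in
theorem theorem4p4 (n k : ℕ) (hn : 5 ≤ n) (h : Fin n → ℕ)
    (P Q : ∀ i, Matrix (Fin (h i + 1)) (Fin (k + 1)) ℂ)
    (hP : ∀ i, (P i).rank = h i + 1) (hQ : ∀ i, (Q i).rank = h i + 1)
    (d : ℕ) (hdim : CriticalLocus.HasProjDim (CriticalLocus.criticalIdeal P Q) d)
    (hexp : (d : ℤ) = 2 * (k : ℤ) - ∑ i, (h i : ℤ))
    (hcodim : d + 1 = k) :
    ¬ CriticalLocus.IsIrreducibleLocus (CriticalLocus.criticalLocus P Q) ∨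
      CriticalLocus.IsSingular (CriticalLocus.criticalIdeal P Q) := by
  refine or_iff_not_imp_left.2 fun hirr => ?_
  rw [not_not] at hirr
  have hsum : ∑ i, h i = k + 1 := by
    have : ((∑ i, h i : ℕ) : ℤ) = ∑ i, (h i : ℤ) := by push_cast; rfl
    omega
  have hlt : ringKrullDim (CoordRing k ⧸ criticalIdeal P Q) < ((k + 1 : ℕ) : WithBot ℕ∞) := by
    rw [hdim, hcodim]
    exact_mod_cast Nat.lt_succ_self k
  obtain ⟨i, j, hij, hlow | ⟨rfl, hi, hj⟩⟩ := exists_ne_add_le hn (by omega) h hsum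
  -- A common point of the two centres: `hᵢ + hⱼ + 2 ≤ k` linear conditions on `k + 1` coordinates.
  · obtain ⟨x, hx⟩ := exists_point_of_finrank_lt ((Q i).mulVecLin.prod (Q j).mulVecLin) (by
      rw [Module.finrank_prod, Module.finrank_fin_fun, Module.finrank_fin_fun]; omega)
    simp only [LinearMap.prod_apply, Function.prod_apply, Prod.mk_eq_zero,
      Matrix.mulVecLin_apply] at hx
    exact isSingular_of_le_sq x (criticalIdeal_le_sq P Q hij hx.1 hx.2) hlt
  · obtain ⟨x, hx⟩ := exists_point_of_finrank_lt (Q i).mulVecLin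
      (by rw [Module.finrank_fin_fun]; omega)
    obtain ⟨y, hy⟩ := exists_point_of_finrank_lt (Q j).mulVecLin
      (by rw [Module.finrank_fin_fun]; omega)
    rw [Matrix.mulVecLin_apply] at hx hy
    -- Either `y` lies in both centres, or it is a point of the locus off the hyperplane `Qᵢ(X) =
    -- 0`, so that irreducibility applies.
    by_cases hyi : (Q i).mulVec y.rep = 0
    · exact isSingular_of_le_sq y (criticalIdeal_le_sq P Q hij hyi hy) hlt
    · exact isSingular_of_le_sq x (criticalIdeal_le_sq_of_irreducible P Q hirr hi hx hyi
        (mem_criticalLocus P Q hy)) hlt
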